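/- Let $K$ be a number field in which $-1$ is not a square, and let $n = 2^{\alpha} k$ with $\alpha \ge 2$ and $k$ odd. Then there is a cyclic Galois extension $L/K$ of degree $n$ such that the following holds for every generator $\sigma$ of $\mathrm{Gal}(L/K)$. For $b \in L$ let $f_{b,\sigma}$ be the alternating $K$-bilinear form on $L$ given by $$f_{b,\sigma}(x,y) = \mathrm{Tr}_{L/K}\bigl(b\,(x\,\sigma(y) - \sigma(x)\,y)\bigr),$$ and let $A^1 = \{f_{b,\sigma} : b \in L\}$, a $K$-subspace of the space of all alternating $K$-bilinear forms on $L$. Call a subspace of alternating forms an $r$-subspace if all its nonzero elements have rank $r$ (so the nonzero forms in an $n$-subspace are non-degenerate). Then $$A^1 = \mathcal{E}_1 \oplus \cdots \oplus \mathcal{E}_{\alpha-1} \oplus \mathcal{V}_1 \oplus \mathcal{V}_2,$$ where (i) for $1 \le i \le \alpha - 1$, $\mathcal{E}_i = \{f_{b,\sigma} : b \in L,\ \sigma^{n/2^i}(b) = -b\}$ is an $n$-subspace of $K$-dimension $n/2^i$; (ii) $\mathcal{V}_1 = \{f_{b,\sigma} : b \in L,\ \sigma^{k}(b) = b\}$ and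 $\mathcal{V}_2 = \{f_{b,\sigma} : b \in L,\ \sigma^{k}(b) = -b\}$ are $(n-2)$-subspaces of $K$-dimension $k$. -/

import Mathlib

universe u

namespace CyclicSkew

/-- The space `Alt_K(V)` of alternating `K`-bilinear forms (skew-forms) on `V`, as a subspace of
the space of all bilinear forms. -/
def altForms (K V : Type*) [Field K] [AddCommGroup V] [Module K V] :
    Submodule K (LinearMap.BilinForm K V) where
  carrier := {f | f.IsAlt}
  zero_mem' := fun _ => rfl
  add_mem' := fun hf hg x => by
    rw [LinearMap.add_apply, LinearMap.add_apply, hf x, hg x, add_zero]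
  smul_mem' := fun c f hf x => by
    rw [LinearMap.smul_apply, LinearMap.smul_apply, hf x, smul_zero]

/-- The rank of a skew-form: the dimension of the image of the induced map `V → V*`. -/
noncomputable def rank {K V : Type*} [Field K] [AddCommGroup V] [Module K V]
    (f : altForms K V) : ℕ :=
  Module.finrank K (LinearMap.range (f : LinearMap.BilinForm K V))

/-- `W` is an `r`-subspace: all its nonzero skew-forms have rank `r`. -/
def IsRankSubspace {K V : Type*} [Field K] [AddCommGroup V] [Module K V]
    (r : ℕ) (W : Submodule K (altForms K V)) : Prop :=
  ∀ f ∈ W, f ≠ 0 → rank f = r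

section

variable {K L : Type*} [Field K] [Field L] [Algebra K L]

/-- The bilinear form `f_{b,σ}(x, y) = Tr_{L/K}(b (x σ(y) - σ(x) y))`. -/
noncomputable def skewBilin (σ : L ≃ₐ[K] L) (b : L) : LinearMap.BilinForm K L :=
  LinearMap.mk₂ K (fun x y => Algebra.trace K L (b * (x * σ y - σ x * y)))
    (fun x x' y => by rw [← map_add]; congr 1; rw [map_add]; ring)
    (fun c x y => by
      rw [← map_smul]; congr 1; rw [map_smul]; simp only [Algebra.smul_def]; ring)
    (fun x y y' => by rw [← map_add]; congr 1; rw [map_add]; ring)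
    (fun c x y => by
      rw [← map_smul]; congr 1; rw [map_smul]; simp only [Algebra.smul_def]; ring)

theorem skewBilin_apply (σ : L ≃ₐ[K] L) (b x y : L) :
    skewBilin σ b x y = Algebra.trace K L (b * (x * σ y - σ x * y)) := rfl

theorem skewBilin_mem (σ : L ≃ₐ[K] L) (b : L) : skewBilin σ b ∈ altForms K L := fun x => by
  rw [skewBilin_apply, mul_comm x, sub_self, mul_zero, map_zero]

/-- The `K`-linear map `b ↦ f_{b,σ}` from `L` to `Alt_K(L)`. -/
noncomputable def skewForm (σ : L ≃ₐ[K] L) : L →ₗ[K] altForms K L where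
  toFun b := ⟨skewBilin σ b, skewBilin_mem σ b⟩
  map_add' b b' := by
    refine Subtype.ext (LinearMap.ext₂ fun x y => ?_)
    change Algebra.trace K L _ = Algebra.trace K L _ + Algebra.trace K L _
    rw [add_mul, map_add]
  map_smul' c b := by
    refine Subtype.ext (LinearMap.ext₂ fun x y => ?_)
    change Algebra.trace K L _ = c • Algebra.trace K L _
    rw [smul_mul_assoc, map_smul]

/-- The space `A^σ = {f_{b,σ} : b ∈ L}`. -/
noncomputable def skewSpace (σ : L ≃ₐ[K] L) : Submodule K (altForms K L) :=
  LinearMap.range (skewForm σ)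

/-- `{f_{b,σ} : b ∈ L, τ(b) = c b}`, the skew-forms that come from the eigenspace of the
automorphism `τ`, seen as a `K`-linear map, for the scalar `c`. -/
noncomputable def eigenForms (σ τ : L ≃ₐ[K] L) (c : K) : Submodule K (altForms K L) :=
  (Module.End.eigenspace (τ.toLinearMap : Module.End K L) c).map (skewForm σ)

end

end CyclicSkew

/-! Choose a prime `p ≡ 1 mod n` larger than the discriminants of `K` and `K(i)`, so that `Φ_p` is
irreducible over both. Then `K(ζ_p)` does not contain `i`, and its subfield of degree `n` over `K`
is the required cyclic `L`.

As the trace form is nondegenerate, `x` lies in the radical of `f_b` iff `b x = σ(b) σ²(x)`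
(`mem_ker_skewBilin_iff`). For `b ≠ 0` a nonzero solution is unique up to a factor fixed by `σ²`, so
the rank is `n` or `n - 2`. The product of the conjugates of `b` under even powers of `σ` decides
which. On `V_1` and `V_2` it yields a solution. On `E_i` a solution would give a root of unity `R`
of 2-power order with `R σ(R) = -1`, impossible because `i ∉ L` forces `R = ±1`
(`ker_skewBilin_eq_bot`).

The decomposition comes from splitting `Fix(σ^(2m))` repeatedly into the `±1`-eigenspaces of `σ^m`;
it passes to forms because `b ↦ f_b` is injective. -/

/-! ### Cyclic extensions without a square root of `-1` -/

open Polynomial in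
/-- The `p`-th cyclotomic polynomial is irreducible over every number field whose discriminant is
prime to `p`, since it is a translate of an Eisenstein polynomial. -/
theorem irreducible_cyclotomic_of_not_dvd_discr (M : Type*) [Field M] [NumberField M] (p : ℕ)
    [hp : Fact p.Prime] (h : ¬ (p : ℤ) ∣ NumberField.discr M) : Irreducible (cyclotomic p M) := by
  have hpZ : Prime (p : ℤ) := Nat.prime_iff_prime_int.1 hp.out
  have hunit : ¬ IsUnit ((p : ℤ) : NumberField.RingOfIntegers M) := by
    intro hu
    have := hu.map (Algebra.norm ℤ)
    rw [show ((p : ℤ) : NumberField.RingOfIntegers M) = algebraMap ℤ _ (p : ℤ) by simp,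
      Algebra.norm_algebraMap] at this
    exact hpZ.not_isUnit (isUnit_pow_iff (Module.finrank_pos.ne') |>.1 this)
  obtain ⟨P, hPmax, hpP⟩ := exists_max_ideal_of_mem_nonunits hunit
  -- `p` is unramified at `P`: otherwise `P` divides the different, which contains the discriminant,
  -- and `P` would contain two coprime integers.
  have hpP2 : ((p : ℤ) : NumberField.RingOfIntegers M) ∉ P ^ 2 := by
    intro hmem
    have hmax : (Ideal.span {(p : ℤ)}).IsMaximal :=
      ((Ideal.span_singleton_prime hpZ.ne_zero).2 hpZ).isMaximal
        (by simpa using hpZ.ne_zero)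
    have hdvd : P ^ (2 - 1) ∣ differentIdeal ℤ (NumberField.RingOfIntegers M) := by
      refine pow_sub_one_dvd_differentIdeal ℤ (p := Ideal.span {(p : ℤ)}) P 2
        (by simpa using hpZ.ne_zero) ?_
      rw [Ideal.dvd_iff_le, Ideal.map_span, Ideal.span_le]
      simpa using hmem
    rw [pow_one, Ideal.dvd_iff_le] at hdvd
    have hd := hdvd (NumberField.discr_mem_differentIdeal M (NumberField.RingOfIntegers M))
    obtain ⟨a, b, hab⟩ := (Prime.coprime_iff_not_dvd hpZ).2 h
    refine hPmax.ne_top ((Ideal.eq_top_iff_one _).2 ?_)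
    have := congrArg (Int.cast : ℤ → NumberField.RingOfIntegers M) hab
    rw [Int.cast_one] at this
    rw [← this, Int.cast_add, Int.cast_mul, Int.cast_mul]
    exact P.add_mem (P.mul_mem_left _ hpP) (P.mul_mem_left _ hd)
  have hE := cyclotomic_comp_X_add_one_isEisensteinAt p
  have hmon : ((cyclotomic p ℤ).comp (X + 1)).Monic := by
    rw [show (X + 1 : ℤ[X]) = X + C 1 by simp]
    exact (cyclotomic.monic p ℤ).comp (monic_X_add_C 1) (by rw [natDegree_X_add_C]; simp)
  have hdeg : ((cyclotomic p ℤ).comp (X + 1)).natDegree = p - 1 := by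
    rw [natDegree_comp, show (X + 1 : ℤ[X]) = X + C 1 by simp, natDegree_X_add_C, mul_one,
      natDegree_cyclotomic, Nat.totient_prime hp.out]
  set φ := Int.castRingHom (NumberField.RingOfIntegers M)
  set g := ((cyclotomic p ℤ).comp (X + 1)).map φ with hg
  have hgmon : g.Monic := hmon.map _
  have hgdeg : g.natDegree = p - 1 := by rw [hg, hmon.natDegree_map, hdeg]
  have hgE : g.IsEisensteinAt P := by
    refine hgmon.isEisensteinAt_of_mem_of_notMem hPmax.ne_top (fun {i} hi => ?_) ?_
    · have := hE.mem (n := i) (by rwa [hdeg, ← hgdeg])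
      rw [Ideal.submodule_span_eq, Ideal.mem_span_singleton] at this
      obtain ⟨c, hc⟩ := this
      rw [hg, coeff_map, hc, map_mul]
      exact P.mul_mem_right _ hpP
    -- The constant term is `Φ_p(1) = p`.
    · rw [hg, coeff_map, coeff_zero_eq_eval_zero, eval_comp, cyclotomic_prime, eval_add, eval_X,
        eval_one, zero_add, eval_geom_sum, one_geom_sum]
      exact hpP2
  have hirr : Irreducible g :=
    hgE.irreducible hPmax.isPrime hgmon.isPrimitive
      (by rw [hgdeg]; have := hp.out.two_le; omega)
  have hirr' := (hgmon.irreducible_iff_irreducible_map_fraction_map (K := M)).1 hirr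
  have : g.map (algebraMap (NumberField.RingOfIntegers M) M) = taylor 1 (cyclotomic p M) := by
    rw [hg, Polynomial.map_map, Polynomial.map_comp, map_cyclotomic, taylor_apply]
    simp
  rw [this] at hirr'
  exact (MulEquiv.irreducible_iff (taylorEquiv (1 : M))).1 hirr'

/-- A cyclic Galois extension contains a cyclic Galois extension of every degree dividing its
own. -/
theorem exists_intermediateField_isCyclic_finrank_eq {K E : Type*} [Field K] [Field E]
    [Algebra K E] [FiniteDimensional K E] [IsGalois K E] [IsCyclic (E ≃ₐ[K] E)] {n : ℕ}
    (hn : n ∣ Module.finrank K E) :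
    ∃ F : IntermediateField K E, IsGalois K F ∧ Module.finrank K F = n ∧
      IsCyclic (F ≃ₐ[K] F) := by
  obtain ⟨g, hg⟩ := IsCyclic.exists_generator (α := E ≃ₐ[K] E)
  have hord : orderOf g = Module.finrank K E := by
    rw [orderOf_eq_card_of_forall_mem_zpowers hg, IsGalois.card_aut_eq_finrank]
  have hpos : 0 < Module.finrank K E := Module.finrank_pos
  have hn0 : n ≠ 0 := by rintro rfl; simp_all
  have hcomm : ∀ a b : E ≃ₐ[K] E, a * b = b * a := (IsCyclic.commGroup (α := E ≃ₐ[K] E)).mul_comm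
  obtain ⟨H, hH⟩ : ∃ H : Subgroup (E ≃ₐ[K] E), Nat.card H = Module.finrank K E / n :=
    ⟨Subgroup.zpowers (g ^ n), by
      rw [Nat.card_zpowers, orderOf_pow_of_dvd hn0 (hord ▸ hn), hord]⟩
  have hnormal : H.Normal := ⟨fun a ha b => by rwa [hcomm b a, mul_inv_cancel_right]⟩
  refine ⟨IntermediateField.fixedField H, inferInstance, ?_, ?_⟩
  · have := Module.finrank_mul_finrank K (IntermediateField.fixedField H) E
    rw [IntermediateField.finrank_fixedField_eq_card, hH] at this
    refine Nat.eq_of_mul_eq_mul_right (Nat.div_pos (Nat.le_of_dvd hpos hn) (Nat.pos_of_ne_zero hn0))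
      (this.trans (Nat.mul_div_cancel' hn).symm)
  · exact isCyclic_of_surjective _
      (AlgEquiv.restrictNormalHom_surjective (F := K) (K₁ := IntermediateField.fixedField H) E)

open Polynomial in
/-- If `Φ_p` is irreducible over `K` and over an extension `M` of `K` that embeds in the `p`-th
cyclotomic extension of `K`, then `M = K`. -/
theorem finrank_eq_one_of_irreducible_cyclotomic {K M E : Type*} [Field K] [Field M] [Field E]
    [Algebra K E] [Algebra K M] {p : ℕ} [NeZero p] [hE : IsCyclotomicExtension {p} K E]
    (hK : Irreducible (cyclotomic p K)) (hM : Irreducible (cyclotomic p M)) (ψ : M →ₐ[K] E) :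
    Module.finrank K M = 1 := by
  let _ : Algebra M E := ψ.toRingHom.toAlgebra
  have : IsScalarTower K M E := IsScalarTower.of_algebraMap_eq' ψ.comp_algebraMap.symm
  -- `E` is also the `p`-th cyclotomic extension of `M`, so `[E : M] = φ(p) = [E : K]`.
  have hME : IsCyclotomicExtension {p} M E := by
    refine (IsCyclotomicExtension.iff_singleton p M E).2
      ⟨((IsCyclotomicExtension.iff_singleton p K E).1 hE).1, fun x => ?_⟩
    have hle : Algebra.adjoin K {b : E | b ^ p = 1} ≤
        (Algebra.adjoin M {b : E | b ^ p = 1}).restrictScalars K :=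
      Algebra.adjoin_le Algebra.subset_adjoin
    exact hle (((IsCyclotomicExtension.iff_singleton p K E).1 hE).2 x)
  have h2 := Module.finrank_mul_finrank K M E
  rw [IsCyclotomicExtension.finrank (n := p) E hM, IsCyclotomicExtension.finrank (n := p) E hK] at h2
  exact Nat.eq_of_mul_eq_mul_right (Nat.totient_pos.2 (NeZero.pos p)) (h2.trans (one_mul _).symm)

open Polynomial in
/-- A number field without a square root of `-1` has cyclic extensions of every degree that do not
contain a square root of `-1` either. -/
theorem exists_isCyclic_finrank_eq_not_isSquare (K : Type u) [Field K] [NumberField K]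
    (hK : ¬ IsSquare (-1 : K)) (n : ℕ) (hn : n ≠ 0) :
    ∃ (L : Type u) (_ : Field L) (_ : Algebra K L), IsGalois K L ∧ Module.finrank K L = n ∧
      IsCyclic (L ≃ₐ[K] L) ∧ ¬ IsSquare (-1 : L) := by
  have hirr : Fact (Irreducible (X ^ 2 + C 1 : K[X])) := ⟨by
    rw [show (X ^ 2 + C 1 : K[X]) = X ^ 2 - C (-1) by simp]
    exact X_pow_sub_C_irreducible_of_prime Nat.prime_two fun b hb => hK ⟨b, by rw [← hb, sq]⟩⟩
  -- `M = K(i)`, of degree 2 over `K`.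
  let M := AdjoinRoot (X ^ 2 + C 1 : K[X])
  have : Module.Finite K M := (AdjoinRoot.powerBasis hirr.out.ne_zero).finite
  have : NumberField M := NumberField.of_module_finite K M
  obtain ⟨p, hp, hpgt, hpmod⟩ := Nat.exists_prime_gt_modEq_one
    (max (NumberField.discr M).natAbs (NumberField.discr K).natAbs) hn
  have : Fact p.Prime := ⟨hp⟩
  have hcyc (F : Type u) [Field F] [NumberField F] (h : (NumberField.discr F).natAbs < p) :
      Irreducible (cyclotomic p F) := by
    refine irreducible_cyclotomic_of_not_dvd_discr F p fun hd => ?_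
    have := Nat.le_of_dvd (Int.natAbs_pos.2 (NumberField.discr_ne_zero F))
      (Int.natCast_dvd.1 hd)
    omega
  have hM := hcyc M (by omega)
  have hKc := hcyc K (by omega)
  have : NeZero p := ⟨hp.ne_zero⟩
  have : NeZero (p : K) := ⟨Nat.cast_ne_zero.2 hp.ne_zero⟩
  have : IsCyclotomicExtension {p} K (CyclotomicField p K) :=
    CyclotomicField.isCyclotomicExtension p K
  have : FiniteDimensional K (CyclotomicField p K) :=
    IsCyclotomicExtension.finite_of_singleton p K _
  have : IsGalois K (CyclotomicField p K) := IsCyclotomicExtension.isGalois {p} K _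
  have hsq : ¬ IsSquare (-1 : CyclotomicField p K) := by
    rintro ⟨i, hi⟩
    -- A square root of `-1` embeds `M` in the cyclotomic field, which forces `[M : K] = 1`.
    have h1 := finrank_eq_one_of_irreducible_cyclotomic (E := CyclotomicField p K) hKc hM
      (AdjoinRoot.liftAlgHom _ (Algebra.ofId K _) i (by simp [sq, ← hi]))
    rw [(AdjoinRoot.powerBasis hirr.out.ne_zero).finrank, AdjoinRoot.powerBasis_dim,
      natDegree_X_pow_add_C] at h1
    omega
  have : IsCyclic (CyclotomicField p K ≃ₐ[K] CyclotomicField p K) :=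
    isCyclic_of_surjective _ (IsCyclotomicExtension.autEquivPow _ hKc).symm.surjective
  obtain ⟨F, hF1, hF2, hF3⟩ := exists_intermediateField_isCyclic_finrank_eq (K := K)
    (E := CyclotomicField p K) (n := n) (by
      rw [IsCyclotomicExtension.finrank (n := p) _ hKc, Nat.totient_prime hp]
      exact (Nat.modEq_iff_dvd' hp.one_le).1 hpmod.symm)
  exact ⟨F, inferInstance, inferInstance, hF1, hF2, hF3, fun ⟨x, hx⟩ =>
    hsq ⟨x, congrArg Subtype.val hx⟩⟩

/-! ### Independence of subspaces -/

/-- The external direct sum maps onto the supremum; equal dimensions make this map injective. -/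
theorem iSupIndep_of_finrank_iSup_eq_sum {ι K V : Type*} [Fintype ι] [Field K] [AddCommGroup V]
    [Module K V] (p : ι → Submodule K V) [∀ i, FiniteDimensional K (p i)]
    (h : Module.finrank K (⨆ i, p i : Submodule K V) = ∑ i, Module.finrank K (p i)) :
    iSupIndep p := by
  classical
  refine iSupIndep_of_dfinsupp_lsum_injective p ?_
  have h1 := LinearMap.finrank_range_add_finrank_ker
    (DFinsupp.lsum ℕ fun i => (p i).subtype)
  have h2 : Module.finrank K (Π₀ i, p i) = ∑ i, Module.finrank K (p i) :=
    Module.finrank_directSum K fun i => ↥(p i)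
  rw [← Submodule.iSup_eq_range_dfinsupp_lsum, h, h2, Nat.add_eq_left,
    Submodule.finrank_eq_zero] at h1
  exact LinearMap.ker_eq_bot.1 h1

theorem iSupIndep.submodule_map {ι R M N : Type*} [Semiring R] [AddCommMonoid M] [AddCommMonoid N]
    [Module R M] [Module R N] {p : ι → Submodule R M} (hp : iSupIndep p) {f : M →ₗ[R] N}
    (hf : Function.Injective f) : iSupIndep fun i => (p i).map f := by
  intro i
  have h : (⨆ (j) (_ : j ≠ i), (p j).map f) = (⨆ (j) (_ : j ≠ i), p j).map f := by
    simp only [Submodule.map_iSup]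
  rw [h, disjoint_iff, ← Submodule.map_inf _ hf, (hp i).eq_bot, Submodule.map_bot]

namespace CyclicSkew

open Module

variable {K L : Type*} [Field K] [Field L] [Algebra K L]

/-! ### Eigenspaces of powers of `σ` -/

theorem mem_eigenspace_one_iff {τ : L ≃ₐ[K] L} {x : L} :
    x ∈ Module.End.eigenspace (τ.toLinearMap : Module.End K L) 1 ↔ τ x = x := by
  rw [Module.End.mem_eigenspace_iff, one_smul]; rfl

theorem mem_eigenspace_neg_one_iff {τ : L ≃ₐ[K] L} {x : L} :
    x ∈ Module.End.eigenspace (τ.toLinearMap : Module.End K L) (-1) ↔ τ x = -x := by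
  rw [Module.End.mem_eigenspace_iff, neg_smul, one_smul]; rfl

/-- Write `x = (x + τ x) / 2 + (x - τ x) / 2`. -/
theorem eigenspace_one_sup_eigenspace_neg_one (h2 : (2 : L) ≠ 0) (τ : L ≃ₐ[K] L) :
    Module.End.eigenspace (τ.toLinearMap : Module.End K L) 1 ⊔
      Module.End.eigenspace (τ.toLinearMap : Module.End K L) (-1) =
      Module.End.eigenspace ((τ ^ 2).toLinearMap : Module.End K L) 1 := by
  refine le_antisymm (sup_le (fun x hx => ?_) fun x hx => ?_) fun x hx => ?_
  · rw [mem_eigenspace_one_iff] at hx ⊢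
    rw [sq, AlgEquiv.mul_apply, hx, hx]
  · rw [mem_eigenspace_neg_one_iff] at hx
    rw [mem_eigenspace_one_iff, sq, AlgEquiv.mul_apply, hx, map_neg, hx, neg_neg]
  · rw [mem_eigenspace_one_iff, sq, AlgEquiv.mul_apply] at hx
    refine Submodule.mem_sup.2 ⟨(x + τ x) / 2, mem_eigenspace_one_iff.2 ?_, (x - τ x) / 2,
      mem_eigenspace_neg_one_iff.2 ?_, ?_⟩
    · rw [map_div₀, map_add, hx, map_ofNat, add_comm]
    · rw [map_div₀, map_sub, hx, map_ofNat, ← neg_div, neg_sub]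
    · field_simp
      ring

theorem disjoint_eigenspace_one_eigenspace_neg_one (h2 : (2 : L) ≠ 0) (τ : L ≃ₐ[K] L) :
    Disjoint (Module.End.eigenspace (τ.toLinearMap : Module.End K L) 1)
      (Module.End.eigenspace (τ.toLinearMap : Module.End K L) (-1)) := by
  refine Submodule.disjoint_def.2 fun x hx hx' => ?_
  rw [mem_eigenspace_one_iff] at hx
  rw [mem_eigenspace_neg_one_iff, hx, eq_neg_iff_add_eq_zero, ← two_mul] at hx'
  exact (mul_eq_zero.1 hx').resolve_left h2

/-- This eigenspace is the fixed field of `⟨σ^m⟩`, a subgroup of index `m`. -/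
theorem finrank_eigenspace_pow_one [FiniteDimensional K L] [IsGalois K L] (σ : L ≃ₐ[K] L)
    (hσ : orderOf σ = finrank K L) {m : ℕ} (hm : m ∣ finrank K L) :
    finrank K (Module.End.eigenspace ((σ ^ m).toLinearMap : Module.End K L) 1) = m := by
  have hpos : 0 < finrank K L := finrank_pos
  have hm0 : m ≠ 0 := by rintro rfl; simp_all
  have heq : Module.End.eigenspace ((σ ^ m).toLinearMap : Module.End K L) 1 =
      Subalgebra.toSubmodule
        (IntermediateField.fixedField (Subgroup.zpowers (σ ^ m))).toSubalgebra := by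
    ext x
    rw [mem_eigenspace_one_iff, Subalgebra.mem_toSubmodule, IntermediateField.mem_toSubalgebra,
      IntermediateField.mem_fixedField_iff]
    refine ⟨fun hx f hf => ?_, fun hx => hx _ (Subgroup.mem_zpowers _)⟩
    have hle : Subgroup.zpowers (σ ^ m) ≤ MulAction.stabilizer (L ≃ₐ[K] L) x :=
      (Subgroup.zpowers_le).2 hx
    exact hle hf
  rw [heq]
  have := finrank_mul_finrank K (IntermediateField.fixedField (Subgroup.zpowers (σ ^ m))) L
  rw [IntermediateField.finrank_fixedField_eq_card, Nat.card_zpowers,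
    orderOf_pow_of_dvd hm0 (hσ ▸ hm), hσ] at this
  exact Nat.eq_of_mul_eq_mul_right (Nat.div_pos (Nat.le_of_dvd hpos hm) (Nat.pos_of_ne_zero hm0))
      (this.trans (Nat.mul_div_cancel' hm).symm)

theorem finrank_eigenspace_pow_neg_one [FiniteDimensional K L] [IsGalois K L] (h2 : (2 : L) ≠ 0)
    (σ : L ≃ₐ[K] L) (hσ : orderOf σ = finrank K L) {m : ℕ} (hm : m * 2 ∣ finrank K L) :
    finrank K (Module.End.eigenspace ((σ ^ m).toLinearMap : Module.End K L) (-1)) = m := by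
  have h := Submodule.finrank_sup_add_finrank_inf_eq
    (Module.End.eigenspace ((σ ^ m).toLinearMap : Module.End K L) 1)
    (Module.End.eigenspace ((σ ^ m).toLinearMap : Module.End K L) (-1))
  rw [(disjoint_eigenspace_one_eigenspace_neg_one h2 _).eq_bot, finrank_bot,
    eigenspace_one_sup_eigenspace_neg_one h2, ← pow_mul, finrank_eigenspace_pow_one σ hσ hm,
    finrank_eigenspace_pow_one σ hσ (dvd_of_mul_right_dvd hm)] at h
  omega

/-! ### The radical of `f_b` -/

/-- Invariance of the trace under `σ` gives `f_b(x, y) = Tr((σ⁻¹(b x) - b σ(x)) y)`, and the trace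
form is nondegenerate. -/
theorem mem_ker_skewBilin_iff [FiniteDimensional K L] [Algebra.IsSeparable K L] {σ : L ≃ₐ[K] L}
    {b x : L} : x ∈ LinearMap.ker (skewBilin σ b) ↔ b * x = σ b * σ (σ x) := by
  have key : skewBilin σ b x = Algebra.traceForm K L (σ.symm (b * x) - b * σ x) := by
    ext y
    have h : σ (σ.symm (b * x) * y) = b * (x * σ y) := by
      rw [map_mul, AlgEquiv.apply_symm_apply, mul_assoc]
    rw [skewBilin_apply, Algebra.traceForm_apply, mul_sub, map_sub, ← h,
      Algebra.trace_eq_of_algEquiv, ← map_sub, sub_mul, mul_assoc]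
  have hker : LinearMap.ker (Algebra.traceForm K L) = ⊥ :=
    LinearMap.separatingLeft_iff_ker_eq_bot.1 (traceForm_nondegenerate K L).1
  rw [LinearMap.mem_ker, key, ← LinearMap.mem_ker, hker, Submodule.mem_bot, sub_eq_zero,
    AlgEquiv.symm_apply_eq, map_mul]

theorem rank_skewForm [FiniteDimensional K L] (σ : L ≃ₐ[K] L) (b : L) :
    rank (skewForm σ b) = finrank K L - finrank K (LinearMap.ker (skewBilin σ b)) :=
  Nat.eq_sub_of_add_eq (LinearMap.finrank_range_add_finrank_ker (skewBilin σ b))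

/-- The quotient of a solution by `x` is fixed by `σ²`, so the radical is `x · Fix(σ²)`. -/
theorem finrank_ker_skewBilin [FiniteDimensional K L] [IsGalois K L] {σ : L ≃ₐ[K] L}
    (hσ : orderOf σ = finrank K L) (h2 : 2 ∣ finrank K L) {b x : L} (hb : b ≠ 0) (hx : x ≠ 0)
    (h : b * x = σ b * σ (σ x)) : finrank K (LinearMap.ker (skewBilin σ b)) = 2 := by
  have heq : LinearMap.ker (skewBilin σ b) =
      (Module.End.eigenspace ((σ ^ 2).toLinearMap : Module.End K L) 1).map
        (LinearMap.mulLeft K x) := by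
    ext y
    rw [mem_ker_skewBilin_iff, Submodule.mem_map]
    have hσx : σ (σ x) ≠ 0 := by simpa using hx
    have hσb : σ b ≠ 0 := by simpa using hb
    refine ⟨fun hy => ⟨y / x, mem_eigenspace_one_iff.2 ?_, mul_div_cancel₀ _ hx⟩, ?_⟩
    · rw [sq, AlgEquiv.mul_apply, map_div₀, map_div₀, div_eq_div_iff hσx hx]
      refine mul_left_cancel₀ (mul_ne_zero hb hσb) ?_
      linear_combination σ b * σ (σ y) * h - σ b * σ (σ x) * hy
    · rintro ⟨z, hz, rfl⟩
      rw [mem_eigenspace_one_iff, sq, AlgEquiv.mul_apply] at hz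
      rw [LinearMap.mulLeft_apply, map_mul, map_mul, hz]
      linear_combination z * h
  have hinj : Function.Injective (LinearMap.mulLeft K x) := mul_right_injective₀ hx
  rw [heq]
  exact (LinearEquiv.finrank_eq (Submodule.equivMapOfInjective _ hinj _)).symm.trans
    (finrank_eigenspace_pow_one σ hσ h2)

/-! ### Products over even powers of `σ` -/

/-- The product `b · σ²(b) ⋯ σ^(2h-2)(b)`. -/
noncomputable def evenProd (σ : L ≃ₐ[K] L) (h : ℕ) (b : L) : L :=
  ∏ j ∈ Finset.range h, (σ ^ (2 * j)) b

theorem evenProd_ne_zero (σ : L ≃ₐ[K] L) (h : ℕ) {b : L} (hb : b ≠ 0) : evenProd σ h b ≠ 0 :=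
  Finset.prod_ne_zero_iff.2 fun j _ => (map_ne_zero (σ ^ (2 * j))).2 hb

theorem evenProd_mul (σ : L ≃ₐ[K] L) (h : ℕ) (b c : L) :
    evenProd σ h (b * c) = evenProd σ h b * evenProd σ h c := by
  simp only [evenProd, map_mul, Finset.prod_mul_distrib]

theorem evenProd_pow_apply (σ : L ≃ₐ[K] L) (h m : ℕ) (b : L) :
    evenProd σ h ((σ ^ m) b) = (σ ^ m) (evenProd σ h b) := by
  simp only [evenProd, map_prod, ← AlgEquiv.mul_apply, ← pow_add, add_comm]

theorem evenProd_apply (σ : L ≃ₐ[K] L) (h : ℕ) (b : L) :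
    evenProd σ h (σ b) = σ (evenProd σ h b) := by
  simpa using evenProd_pow_apply σ h 1 b

theorem evenProd_neg (σ : L ≃ₐ[K] L) (h : ℕ) (b : L) :
    evenProd σ h (-b) = (-1) ^ h * evenProd σ h b := by
  simp [evenProd, Finset.prod_neg]

/-- Telescoping: `σ²` shifts the factors by one place. -/
theorem apply_apply_evenProd_mul (σ : L ≃ₐ[K] L) (h : ℕ) (b : L) :
    σ (σ (evenProd σ h b)) * b = evenProd σ h b * (σ ^ (2 * h)) b := by
  have h1 : σ (σ (evenProd σ h b)) = ∏ j ∈ Finset.range h, (σ ^ (2 * (j + 1))) b := by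
    simp only [evenProd, map_prod, ← AlgEquiv.mul_apply, ← pow_succ', mul_add, mul_one]
  have h2 := Finset.prod_range_succ (fun j => (σ ^ (2 * j)) b) h
  rw [Finset.prod_range_succ'] at h2
  rw [h1, evenProd, ← h2]
  simp

theorem eq_one_or_eq_neg_one_of_pow_two_pow {F : Type*} [Field F] (hF : ¬ IsSquare (-1 : F)) :
    ∀ (i : ℕ) {r : F}, r ^ 2 ^ i = 1 → r = 1 ∨ r = -1
  | 0, r, h => Or.inl (by simpa using h)
  | i + 1, r, h => by
    rw [pow_succ', pow_mul] at h
    rcases eq_one_or_eq_neg_one_of_pow_two_pow hF i h with h | h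
    · exact mul_self_eq_one_iff.1 (by rw [← sq, h])
    · exact absurd ⟨r, by rw [← h, sq]⟩ hF

theorem ker_skewBilin_eq_bot [FiniteDimensional K L] [Algebra.IsSeparable K L]
    (hL : ¬ IsSquare (-1 : L)) {σ : L ≃ₐ[K] L} {h i : ℕ} (hσ : σ ^ (2 * h * 2 ^ i) = 1) {b : L}
    (hb : b ≠ 0) (hbσ : (σ ^ (2 * h)) b = -b) : LinearMap.ker (skewBilin σ b) = ⊥ := by
  refine (Submodule.eq_bot_iff _).2 fun x hx => ?_
  by_contra hx0
  rw [mem_ker_skewBilin_iff] at hx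
  set P := evenProd σ h b with hP
  have hP0 : P ≠ 0 := evenProd_ne_zero σ h hb
  have hσP0 : σ P ≠ 0 := by simpa using hP0
  have hσσP : σ (σ P) = -P := by
    have := apply_apply_evenProd_mul σ h b
    rw [hbσ, mul_neg, ← neg_mul] at this
    exact mul_right_cancel₀ hb this
  -- Apply `evenProd` to the radical equation and telescope the factors in `x`.
  have hPx : P * x = σ P * (σ ^ (2 * h)) x := by
    have h1 := congrArg (evenProd σ h) hx
    rw [evenProd_mul, evenProd_mul, evenProd_apply, evenProd_apply, evenProd_apply] at h1
    have h2 := apply_apply_evenProd_mul σ h x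
    refine mul_left_cancel₀ (evenProd_ne_zero σ h hx0) ?_
    linear_combination x * h1 + σ P * h2
  obtain ⟨R, hR⟩ : ∃ R, R = P / σ P := ⟨_, rfl⟩
  have hRx : (σ ^ (2 * h)) x = R * x := by
    rw [hR, div_mul_eq_mul_div, hPx, mul_div_cancel_left₀ _ hσP0]
  have hRR : R * σ R = -1 := by
    rw [hR, map_div₀, hσσP]
    field_simp
  have hRfix : (σ ^ (2 * h)) R = R := by
    have h1 : (σ ^ (2 * h)) P = (-1) ^ h * P := by
      rw [hP, ← evenProd_pow_apply, hbσ, evenProd_neg]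
    have h2 : (σ ^ (2 * h)) (σ P) = (-1) ^ h * σ P := by
      rw [← AlgEquiv.mul_apply, ← pow_succ, pow_succ', AlgEquiv.mul_apply, h1]
      simp
    rw [hR, map_div₀, h1, h2, mul_div_mul_left _ _ (by simp)]
  have hRt : ∀ t : ℕ, (σ ^ (2 * h * t)) x = R ^ t * x := by
    intro t
    induction t with
    | zero => simp
    | succ t ih =>
      rw [mul_add, mul_one, add_comm, pow_add, AlgEquiv.mul_apply, ih, map_mul, map_pow, hRfix, hRx]
      ring
  have hR1 : R ^ 2 ^ i = 1 := by
    have := hRt (2 ^ i)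
    rw [hσ, AlgEquiv.one_apply] at this
    exact mul_right_cancel₀ hx0 (by rw [one_mul, ← this])
  -- `R = ±1` gives `R σ(R) = 1`, so that `-1 = 1 * 1`.
  refine hL ⟨1, ?_⟩
  rcases eq_one_or_eq_neg_one_of_pow_two_pow hL i hR1 with rfl | rfl <;> simpa using hRR.symm

/-- For `k = 2r + 1` the product `N` of `r + 1` factors satisfies `σ²(N) b = N σ^(k+1)(b) = N σ(b)`,
so `N⁻¹` is a solution. -/
theorem exists_mul_eq_of_pow_apply_eq {σ : L ≃ₐ[K] L} {k : ℕ} (hk : Odd k) {b : L}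
    (hb : b ≠ 0) (hbσ : (σ ^ k) b = b) : ∃ x ≠ 0, b * x = σ b * σ (σ x) := by
  obtain ⟨r, rfl⟩ := hk
  have hP0 := evenProd_ne_zero σ (r + 1) hb
  refine ⟨(evenProd σ (r + 1) b)⁻¹, inv_ne_zero hP0, ?_⟩
  have h1 := apply_apply_evenProd_mul σ (r + 1) b
  rw [show 2 * (r + 1) = (2 * r + 1) + 1 by ring, pow_succ', AlgEquiv.mul_apply, hbσ] at h1
  rw [map_inv₀, map_inv₀, ← div_eq_mul_inv, ← div_eq_mul_inv,
    div_eq_div_iff hP0 (by simpa using hP0)]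
  linear_combination h1

/-- Here `σ^(k+1)(b) = -σ(b)`, and the factor `y` absorbs the extra sign. -/
theorem exists_mul_eq_of_pow_apply_eq_neg {σ : L ≃ₐ[K] L} {k : ℕ} (hk : Odd k) {b y : L}
    (hb : b ≠ 0) (hbσ : (σ ^ k) b = -b) (hy : y ≠ 0) (hyσ : (σ ^ 2) y = -y) :
    ∃ x ≠ 0, b * x = σ b * σ (σ x) := by
  obtain ⟨r, rfl⟩ := hk
  have hP0 := evenProd_ne_zero σ (r + 1) hb
  refine ⟨y / evenProd σ (r + 1) b, div_ne_zero hy hP0, ?_⟩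
  have h1 := apply_apply_evenProd_mul σ (r + 1) b
  rw [show 2 * (r + 1) = (2 * r + 1) + 1 by ring, pow_succ', AlgEquiv.mul_apply, hbσ, map_neg] at h1
  rw [sq, AlgEquiv.mul_apply] at hyσ
  rw [map_div₀, map_div₀, hyσ, ← mul_div_assoc, ← mul_div_assoc,
    div_eq_div_iff hP0 (by simpa using hP0)]
  linear_combination y * h1

/-- If `f_b = 0`, every `x` solves the radical equation; `x = 1` gives `σ(b) = b`, and then `σ² = 1`
unless `b = 0`. -/
theorem skewForm_injective [FiniteDimensional K L] [Algebra.IsSeparable K L] {σ : L ≃ₐ[K] L}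
    (hσ : σ ^ 2 ≠ 1) : Function.Injective (skewForm σ) := by
  refine (injective_iff_map_eq_zero _).2 fun b hb => ?_
  by_contra hb0
  have hker (x : L) : b * x = σ b * σ (σ x) := by
    rw [← mem_ker_skewBilin_iff, LinearMap.mem_ker]
    exact congrArg (fun f : altForms K L => (f : LinearMap.BilinForm K L) x) hb
  have h1 : b = σ b := by simpa using hker 1
  refine hσ (AlgEquiv.ext fun x => mul_left_cancel₀ hb0 ?_)
  rw [sq, AlgEquiv.mul_apply, AlgEquiv.one_apply, hker x, ← h1]

/-! ### The decomposition -/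

theorem isRankSubspace_eigenForms {σ τ : L ≃ₐ[K] L} {c : K} {r : ℕ}
    (h : ∀ b ≠ 0, τ b = c • b → rank (skewForm σ b) = r) :
    IsRankSubspace r (eigenForms σ τ c) := by
  rintro f ⟨b, hb, rfl⟩ hf
  exact h b (by rintro rfl; simp at hf) (Module.End.mem_eigenspace_iff.1 hb)

theorem finrank_eigenForms {σ τ : L ≃ₐ[K] L} (hσ : Function.Injective (skewForm σ)) (c : K) :
    finrank K (eigenForms σ τ c) =
      finrank K (Module.End.eigenspace (τ.toLinearMap : Module.End K L) c) :=
  (LinearEquiv.finrank_eq (Submodule.equivMapOfInjective _ hσ _)).symm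

theorem sum_two_pow_sub_mul_add (a k : ℕ) :
    ∑ i : Fin a, 2 ^ (a - i) * k + 2 * k = 2 ^ (a + 1) * k := by
  induction a with
  | zero => simp
  | succ a ih =>
    rw [Fin.sum_univ_succ]
    simp only [Fin.val_zero, Fin.val_succ, Nat.add_sub_add_right, Nat.sub_zero]
    rw [add_assoc, ih]
    ring

theorem two_pow_mul_div (α k : ℕ) {i : ℕ} (hi : i ≤ α) : 2 ^ α * k / 2 ^ i = 2 ^ (α - i) * k := by
  obtain ⟨d, rfl⟩ := Nat.exists_eq_add_of_le' hi
  rw [pow_add, Nat.add_sub_cancel, mul_right_comm, Nat.mul_div_cancel _ (by positivity)]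

/-- The spaces `{b : σ^(2^i k)(b) = -b}` for `i < j` and `{b : σ^k(b) = b}` together span
`{b : σ^(2^j k)(b) = b}`. -/
theorem eigenspace_pow_two_pow_mul_le {σ : L ≃ₐ[K] L} {k : ℕ} (h2 : (2 : L) ≠ 0)
    (S : Submodule K L)
    (h0 : Module.End.eigenspace ((σ ^ k).toLinearMap : Module.End K L) 1 ≤ S) (j : ℕ)
    (h : ∀ i < j, Module.End.eigenspace ((σ ^ (2 ^ i * k)).toLinearMap : Module.End K L) (-1) ≤ S) :
    Module.End.eigenspace ((σ ^ (2 ^ j * k)).toLinearMap : Module.End K L) 1 ≤ S := by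
  induction j with
  | zero => simpa using h0
  | succ j ih =>
    rw [pow_succ, mul_right_comm, pow_mul, ← eigenspace_one_sup_eigenspace_neg_one h2]
    exact sup_le (ih fun i hi => h i (hi.trans j.lt_succ_self)) (h j j.lt_succ_self)

theorem iSupIndep_eigenspace_and_iSup_eq_top [FiniteDimensional K L] [IsGalois K L]
    (h2 : (2 : L) ≠ 0) {σ : L ≃ₐ[K] L} (hσ : orderOf σ = finrank K L) {a k : ℕ}
    (hn : finrank K L = 2 ^ (a + 1) * k) (p : Fin a ⊕ Fin 2 → Submodule K L)
    (hE : ∀ i : Fin a, p (Sum.inl i) =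
      Module.End.eigenspace ((σ ^ (2 ^ (a - i) * k)).toLinearMap : Module.End K L) (-1))
    (hV0 : p (Sum.inr 0) = Module.End.eigenspace ((σ ^ k).toLinearMap : Module.End K L) 1)
    (hV1 : p (Sum.inr 1) = Module.End.eigenspace ((σ ^ k).toLinearMap : Module.End K L) (-1)) :
    iSupIndep p ∧ ⨆ s, p s = ⊤ := by
  have hk2 : k * 2 ∣ finrank K L := by
    rw [hn, pow_succ]; exact Dvd.intro_left (2 ^ a) (by ring)
  have hsup : ⨆ s, p s = ⊤ := by
    refine top_unique (le_trans (fun x _ => ?_) (eigenspace_pow_two_pow_mul_le (σ := σ) (k := k) h2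
      (⨆ s, p s) (hV0.symm.trans_le (le_iSup p _)) (a + 1) fun i hi => ?_))
    · rw [mem_eigenspace_one_iff, ← hn, ← hσ, pow_orderOf_eq_one, AlgEquiv.one_apply]
    · rcases Nat.eq_zero_or_pos i with rfl | hi0
      · rw [pow_zero, one_mul]
        exact hV1.symm.trans_le (le_iSup p _)
      -- The family lists the exponents `2^i k` in decreasing order, so exponent `i` has index `a -
      -- i`.
      · have h1 := (hE ⟨a - i, by omega⟩).symm
        rw [show a - (a - i) = i by omega] at h1
        exact h1.trans_le (le_iSup p _)
  refine ⟨iSupIndep_of_finrank_iSup_eq_sum p ?_, hsup⟩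
  have hEfin (i : Fin a) : finrank K (p (Sum.inl i)) = 2 ^ (a - i) * k := by
    rw [hE, finrank_eigenspace_pow_neg_one h2 σ hσ]
    rw [hn, mul_right_comm, ← pow_succ]
    exact mul_dvd_mul_right (pow_dvd_pow 2 (by omega)) k
  rw [hsup, finrank_top, hn, Fintype.sum_sum_type, Fin.sum_univ_two, hV0, hV1,
    finrank_eigenspace_pow_one σ hσ (dvd_of_mul_right_dvd hk2),
    finrank_eigenspace_pow_neg_one h2 σ hσ hk2, Finset.sum_congr rfl fun i _ => hEfin i, ← two_mul]
  exact (sum_two_pow_sub_mul_add a k).symm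

theorem skewSpace_decomposition [FiniteDimensional K L] [IsGalois K L] {σ : L ≃ₐ[K] L}
    (hL : ¬ IsSquare (-1 : L)) {n α k : ℕ} (hα : 2 ≤ α) (hk : Odd k)
    (hn : n = 2 ^ α * k) (hLn : finrank K L = n) (hσn : orderOf σ = n)
    (E : Fin (α - 1) → Submodule K (altForms K L)) (V : Fin 2 → Submodule K (altForms K L))
    (hE : ∀ i, E i = eigenForms σ (σ ^ (n / 2 ^ (i.val + 1))) (-1))
    (hV0 : V 0 = eigenForms σ (σ ^ k) 1) (hV1 : V 1 = eigenForms σ (σ ^ k) (-1)) :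
    iSupIndep (Sum.elim E V) ∧ (⨆ s, Sum.elim E V s) = skewSpace σ ∧
      (∀ i, IsRankSubspace n (E i) ∧ finrank K (E i) = n / 2 ^ (i.val + 1)) ∧
      ∀ j, IsRankSubspace (n - 2) (V j) ∧ finrank K (V j) = k := by
  have h2 : (2 : L) ≠ 0 := fun h => hL ⟨1, by linear_combination -h⟩
  have hσ : orderOf σ = finrank K L := hσn.trans hLn.symm
  obtain ⟨β, rfl⟩ : ∃ β, α = β + 2 := ⟨α - 2, by omega⟩
  have h4 : 2 * 2 ∣ finrank K L := by
    rw [hLn, hn, pow_add]; exact Dvd.intro_left (2 ^ β * k) (by ring)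
  have h22 : 2 ∣ finrank K L := dvd_of_mul_right_dvd h4
  have hinj : Function.Injective (skewForm σ) := skewForm_injective fun h => by
    have h1 := orderOf_dvd_of_pow_eq_one h
    rw [hσ] at h1
    exact absurd (Nat.le_of_dvd two_pos (h4.trans h1)) (by norm_num)
  have hk2 : k * 2 ∣ finrank K L := by
    rw [hLn, hn, pow_add]; exact Dvd.intro_left (2 ^ β * 2) (by ring)
  have hdiv (i : Fin (β + 2 - 1)) : n / 2 ^ (i.val + 1) = 2 ^ (β + 1 - i) * k := by
    rw [hn, two_pow_mul_div _ _ (by omega), show β + 2 - (i.val + 1) = β + 1 - i by omega]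
  have hEfin (i : Fin (β + 2 - 1)) : finrank K (E i) = 2 ^ (β + 1 - i) * k := by
    rw [hE, finrank_eigenForms hinj, hdiv, finrank_eigenspace_pow_neg_one h2 σ hσ]
    rw [hLn, hn, mul_right_comm, ← pow_succ]
    exact mul_dvd_mul_right (pow_dvd_pow 2 (by omega)) k
  have hV0fin : finrank K (V 0) = k := by
    rw [hV0, finrank_eigenForms hinj, finrank_eigenspace_pow_one σ hσ (dvd_of_mul_right_dvd hk2)]
  have hV1fin : finrank K (V 1) = k := by
    rw [hV1, finrank_eigenForms hinj, finrank_eigenspace_pow_neg_one h2 σ hσ hk2]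
  obtain ⟨hind, hsup⟩ := iSupIndep_eigenspace_and_iSup_eq_top h2 hσ (a := β + 1) (k := k)
    (hLn.trans hn) (Sum.elim
      (fun i => Module.End.eigenspace
        ((σ ^ (2 ^ (β + 1 - i) * k)).toLinearMap : Module.End K L) (-1))
      ![Module.End.eigenspace ((σ ^ k).toLinearMap : Module.End K L) 1,
        Module.End.eigenspace ((σ ^ k).toLinearMap : Module.End K L) (-1)])
    (fun _ => rfl) rfl rfl
  set p : Fin (β + 1) ⊕ Fin 2 → Submodule K L := Sum.elim _ _
  have hmap : Sum.elim E V = fun s => (p s).map (skewForm σ) := by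
    funext s
    rcases s with i | j
    · exact (hE i).trans (by rw [hdiv]; rfl)
    · fin_cases j
      · exact hV0
      · exact hV1
  rw [hmap]
  refine ⟨hind.submodule_map hinj, ?_, fun i => ⟨?_, (hEfin i).trans (hdiv i).symm⟩, fun j => ⟨?_, ?_⟩⟩
  · refine (Submodule.map_iSup _ _).symm.trans ?_
    exact (congrArg _ hsup).trans (LinearMap.range_eq_map _).symm
  · rw [hE]
    refine isRankSubspace_eigenForms fun b hb hbσ => ?_
    have hi : i.val ≤ β := by omega
    -- `h` is half of `n / 2^(i+1)`, which is even since `i ≤ β`; thus `2h · 2^(i+1) = n`.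
    rw [rank_skewForm, ker_skewBilin_eq_bot hL (h := 2 ^ (β - i) * k) (i := i + 1) ?_ hb ?_,
      finrank_bot, hLn, Nat.sub_zero]
    · rw [← pow_orderOf_eq_one σ, hσn, hn]
      congr 1
      obtain ⟨d, hd⟩ := Nat.exists_eq_add_of_le' hi
      rw [show β - i.val = d by omega,
        show 2 ^ (β + 2) = 2 ^ (d + i.val + 2) from congrArg (fun e => 2 ^ (e + 2)) hd]
      ring
    · rw [neg_smul, one_smul, hdiv, show β + 1 - i.val = β - i + 1 by omega] at hbσ
      rwa [← mul_assoc, ← pow_succ']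
  -- Since `4 ∣ n`, the `-1`-eigenspace of `σ²` has dimension 2; `V 1` needs a nonzero element of
  -- it.
  · obtain ⟨y, hy, hy0⟩ := Submodule.exists_mem_ne_zero_of_ne_bot
      (p := Module.End.eigenspace ((σ ^ 2).toLinearMap : Module.End K L) (-1)) fun h => by
        have := finrank_eigenspace_pow_neg_one h2 σ hσ h4
        rw [h, finrank_bot] at this
        omega
    rw [mem_eigenspace_neg_one_iff] at hy
    fin_cases j
    · refine hV0 ▸ isRankSubspace_eigenForms fun b hb hbσ => ?_
      rw [one_smul] at hbσ
      obtain ⟨x, hx, hbx⟩ := exists_mul_eq_of_pow_apply_eq hk hb hbσ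
      rw [rank_skewForm, finrank_ker_skewBilin hσ h22 hb hx hbx, hLn]
    · refine hV1 ▸ isRankSubspace_eigenForms fun b hb hbσ => ?_
      rw [neg_smul, one_smul] at hbσ
      obtain ⟨x, hx, hbx⟩ := exists_mul_eq_of_pow_apply_eq_neg hk hb hbσ hy0 hy
      rw [rank_skewForm, finrank_ker_skewBilin hσ h22 hb hx hbx, hLn]
  · fin_cases j
    · exact hV0fin
    · exact hV1fin

end CyclicSkew

theorem theoremB (K : Type u) [Field K] [NumberField K] (hK : ¬ IsSquare (-1 : K))
    (n α k : ℕ) (hα : 2 ≤ α) (hk : Odd k) (hn : n = 2 ^ α * k) :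
    ∃ (L : Type u) (_ : Field L) (_ : Algebra K L),
      IsGalois K L ∧ Module.finrank K L = n ∧ IsCyclic (L ≃ₐ[K] L) ∧
      ∀ σ : L ≃ₐ[K] L, Subgroup.zpowers σ = ⊤ →
        ∃ (E : Fin (α - 1) → Submodule K (CyclicSkew.altForms K L))
          (V : Fin 2 → Submodule K (CyclicSkew.altForms K L)),
          -- the sum of all the `E i` and `V j` is direct and equal to `A^σ`
          iSupIndep (Sum.elim E V) ∧
          (⨆ s, Sum.elim E V s) = CyclicSkew.skewSpace σ ∧
          -- the index `i : Fin (α - 1)` stands for `i + 1` in `{1, …, α - 1}`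
          (∀ i : Fin (α - 1),
            CyclicSkew.IsRankSubspace n (E i) ∧
            Module.finrank K (E i) = n / 2 ^ (i.val + 1) ∧
            E i = CyclicSkew.eigenForms σ (σ ^ (n / 2 ^ (i.val + 1))) (-1)) ∧
          (∀ j : Fin 2,
            CyclicSkew.IsRankSubspace (n - 2) (V j) ∧
            Module.finrank K (V j) = k) ∧
          V 0 = CyclicSkew.eigenForms σ (σ ^ k) 1 ∧
          V 1 = CyclicSkew.eigenForms σ (σ ^ k) (-1) := by
  have hn0 : n ≠ 0 := by rw [hn]; exact mul_ne_zero (by positivity) hk.pos.ne'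
  obtain ⟨L, _, _, hgal, hrank, hcyc, hL⟩ := exists_isCyclic_finrank_eq_not_isSquare K hK n hn0
  refine ⟨L, inferInstance, inferInstance, hgal, hrank, hcyc, fun σ hσ => ?_⟩
  have : FiniteDimensional K L := FiniteDimensional.of_finrank_pos (by omega)
  have hord : orderOf σ = n := by
    rw [← Nat.card_zpowers, hσ, Subgroup.card_top, IsGalois.card_aut_eq_finrank, hrank]
  let E (i : Fin (α - 1)) := CyclicSkew.eigenForms σ (σ ^ (n / 2 ^ (i.val + 1))) (-1)
  let V := ![CyclicSkew.eigenForms σ (σ ^ k) 1, CyclicSkew.eigenForms σ (σ ^ k) (-1)]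
  obtain ⟨hind, hsup, hE, hV⟩ := CyclicSkew.skewSpace_decomposition hL hα hk hn hrank hord E V
    (fun _ => rfl) rfl rfl
  exact ⟨E, V, hind, hsup, fun i => ⟨(hE i).1, (hE i).2, rfl⟩, hV, rfl, rfl⟩
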